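/- Let $d\in\mathbb N$, let $T>0$, and let $b:\mathbb R^d\to\mathbb R^d$ be differentiable. Suppose there are constants $L_b>0$ and $C>0$ such that for all $x,y\in\mathbb R^d$ $$|b(x)-b(y)|\le L_b|x-y| \qquad\text{and}\qquad |\nabla b(x)-\nabla b(y)|\le C|x-y| ,$$ where $|\cdot|$ is the Euclidean norm on $\mathbb R^d$ and, for the Jacobian matrices $\nabla b$, the associated operator norm. For $\delta>0$ let $Q$ be the transition kernel on $\mathbb R^d$ of the Markov chain $$X_{k+1}=X_k+\delta\, b(X_k)+\sqrt{2T\delta}\,Z_{k+1},$$ where $(Z_k)_{k\ge1}$ are i.i.d. standard normal random vectors in $\mathbb R^d$; let $Q^n$ be its $n$-step kernel, and for $z\in\mathbb R^d$ let $\delta_zQ^n$ be the law of $X_n$ when $X_0=z$. For probability measures $\nu,\mu$ on $\mathbb R^d$ let $\mathcal H(\nu|\mu)=\int\log\frac{d\nu}{d\mu}\,d\nu$ if $\nu\ll\mu$ and $\mathcal H(\nu|\mu)=+\infty$ otherwise. Let $c>0$ and assume that $$0<\delta\le\frac{1}{16\,c\,L_b^2\exp(2cL_b)} .$$ Then, for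 all integers $n\ge2$ with $n\delta<c$ and all $x,y\in\mathbb R^d$, $$\mathcal H(\delta_yQ^n\,|\,\delta_xQ^n)\le\left(\frac1{2T}\left(cL_b^2+\frac1{n\delta}\right)+\frac12c^2C^2d\,\exp(2cL_b)\right)|x-y|^2 .$$ -/

import Mathlib

open MeasureTheory ProbabilityTheory InformationTheory

open scoped NNReal ENNReal

noncomputable section

/-- One-step transition kernel of the Euler chain
`X_{k+1} = X_k + δ b(X_k) + √(2 T δ) Z_{k+1}` on `ℝ^d`, with `Z_{k+1}` standard normal: from `x`
the next state is distributed as `x + δ b(x) + √(2 T δ) Z`. -/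
def eulerKernel {d : ℕ} (b : EuclideanSpace ℝ (Fin d) → EuclideanSpace ℝ (Fin d))
    (hb : Measurable b) (δ T : ℝ) :
    Kernel (EuclideanSpace ℝ (Fin d)) (EuclideanSpace ℝ (Fin d)) where
  toFun x := (stdGaussian (EuclideanSpace ℝ (Fin d))).map
    (fun z => x + δ • b x + √(2 * T * δ) • z)
  measurable' := by
    refine Measure.measurable_of_measurable_coe _ fun s hs => ?_
    have hF : Measurable (fun p : EuclideanSpace ℝ (Fin d) × EuclideanSpace ℝ (Fin d) =>
        p.1 + δ • b p.1 + √(2 * T * δ) • p.2) := by fun_prop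
    have h := measurable_measure_prodMk_left
      (ν := stdGaussian (EuclideanSpace ℝ (Fin d))) (hF hs)
    have he : (fun x : EuclideanSpace ℝ (Fin d) =>
        (stdGaussian (EuclideanSpace ℝ (Fin d))).map
          (fun z => x + δ • b x + √(2 * T * δ) • z) s) =
        fun x => stdGaussian (EuclideanSpace ℝ (Fin d))
          (Prod.mk x ⁻¹' ((fun p : EuclideanSpace ℝ (Fin d) × EuclideanSpace ℝ (Fin d) =>
            p.1 + δ • b p.1 + √(2 * T * δ) • p.2) ⁻¹' s)) := by
      ext x
      rw [Measure.map_apply (by fun_prop) hs]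
      rfl
    rw [he]
    exact h

/-- The law `μ Q^n` after `n` steps of a chain with transition kernel `Q` and initial law `μ`. -/
def lawAfter {α : Type*} [MeasurableSpace α] (μ : Measure α) (Q : Kernel α α) (n : ℕ) :
    Measure α :=
  μ.bind (Q ^ n : Kernel α α)

end

/-! Interpolate by translation. The law of the chain from `y` is shifted at time `k` by `(1 - k / n)
• (x - y)`: at time `0` it is the Dirac mass at `x`, so the divergence vanishes, and at time `n` the
shift is gone. By the chain rule and data processing (`klDiv_bind_le_add`), each step adds at most
the worst divergence between two Gaussians of covariance `2Tδ I`. With `r = ‖x - y‖`, their means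
differ by at most `δLr` (drift, Lipschitz) plus `r / n` (change of shift), as in
`klDiv_map_add_bind_eulerKernel_le`. Summing `n` such costs gives the first term of the bound; the
Jacobian term is nonnegative slack. -/

/-! ### Divergence and Markov kernels. -/

/-- The Kullback-Leibler divergence between the composition-products of one measure with two
kernels is at most any uniform bound on the divergences between the kernels. -/
theorem klDiv_compProd_le_of_forall_le {α β : Type*} [MeasurableSpace α] [MeasurableSpace β]
    [MeasurableSpace.CountableOrCountablyGenerated α β] (μ : Measure α) [IsProbabilityMeasure μ]
    (κ η : Kernel α β) [IsMarkovKernel κ] [IsMarkovKernel η] {K : ℝ≥0∞} (hK : K ≠ ∞)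
    (h : ∀ a, klDiv (κ a) (η a) ≤ K) :
    klDiv (μ ⊗ₘ κ) (μ ⊗ₘ η) ≤ K := by
  have hac : ∀ a, κ a ≪ η a := fun a =>
    (klDiv_ne_top_iff.mp ((h a).trans_lt hK.lt_top).ne).1
  -- The kernel derivative is jointly measurable, so it also serves as the density of the
  -- composition-products.
  have hκ : η.withDensity (κ.rnDeriv η) = κ := by
    ext1 a
    exact Kernel.withDensity_rnDeriv_eq (hac a)
  have hm : Measurable fun p : α × β => κ.rnDeriv η p.1 p.2 := Kernel.measurable_rnDeriv κ η
  have : IsSFiniteKernel (η.withDensity (κ.rnDeriv η)) := by rw [hκ]; infer_instance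
  have hdens : μ ⊗ₘ κ = (μ ⊗ₘ η).withDensity fun p => κ.rnDeriv η p.1 p.2 := by
    conv_lhs => rw [← hκ]
    exact Measure.compProd_withDensity hm
  have hacp : μ ⊗ₘ κ ≪ μ ⊗ₘ η := by
    rw [hdens]
    exact withDensity_absolutelyContinuous _ _
  have hrn : (μ ⊗ₘ κ).rnDeriv (μ ⊗ₘ η) =ᵐ[μ ⊗ₘ η] fun p => κ.rnDeriv η p.1 p.2 := by
    rw [hdens]
    exact Measure.rnDeriv_withDensity _ hm
  rw [klDiv_eq_lintegral_klFun_of_ac hacp]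
  calc ∫⁻ p, ENNReal.ofReal (klFun ((μ ⊗ₘ κ).rnDeriv (μ ⊗ₘ η) p).toReal) ∂(μ ⊗ₘ η)
      = ∫⁻ p, ENNReal.ofReal (klFun (κ.rnDeriv η p.1 p.2).toReal) ∂(μ ⊗ₘ η) := by
        refine lintegral_congr_ae ?_
        filter_upwards [hrn] with p hp
        rw [hp]
    _ = ∫⁻ a, ∫⁻ z, ENNReal.ofReal (klFun (κ.rnDeriv η a z).toReal) ∂(η a) ∂μ :=
        Measure.lintegral_compProd (by fun_prop)
    _ ≤ ∫⁻ _, K ∂μ := by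
        refine lintegral_mono fun a => ?_
        refine le_trans (le_of_eq ?_) (h a)
        rw [klDiv_eq_lintegral_klFun_of_ac (hac a)]
        refine lintegral_congr_ae ?_
        filter_upwards [Kernel.rnDeriv_eq_rnDeriv_measure (κ := κ) (η := η) (a := a)] with z hz
        rw [hz]
    _ = K := by simp

/-- One step of two Markov chains increases the Kullback-Leibler divergence between their laws by
at most the largest divergence between the transition kernels. -/
theorem klDiv_bind_le_add {α β : Type*} [MeasurableSpace α] [MeasurableSpace β]
    [MeasurableSpace.CountableOrCountablyGenerated α β] (μ ν : Measure α) [IsProbabilityMeasure μ]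
    [IsProbabilityMeasure ν] (κ η : Kernel α β) [IsMarkovKernel κ] [IsMarkovKernel η] {K : ℝ≥0∞}
    (hK : K ≠ ∞) (h : ∀ a, klDiv (κ a) (η a) ≤ K) :
    klDiv (μ.bind κ) (ν.bind η) ≤ klDiv μ ν + K := by
  calc klDiv (μ.bind κ) (ν.bind η)
      ≤ klDiv (μ ⊗ₘ κ) (ν ⊗ₘ η) := by
        rw [← Measure.snd_compProd, ← Measure.snd_compProd]
        exact klDiv_map_le _ _ measurable_snd
    _ = klDiv μ ν + klDiv (μ ⊗ₘ κ) (μ ⊗ₘ η) := klDiv_compProd_eq_add ..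
    _ ≤ klDiv μ ν + K := by
        gcongr
        exact klDiv_compProd_le_of_forall_le μ κ η hK h

/-! ### Divergence between Gaussians. -/

/-- The Kullback-Leibler divergence of a probability measure with density `exp g`. -/
theorem klDiv_eq_ofReal_integral_of_withDensity_exp {α : Type*} [MeasurableSpace α]
    {μ ν : Measure α} [IsProbabilityMeasure μ] [IsProbabilityMeasure ν] {g : α → ℝ}
    (hg : Measurable g) (hμ : μ = ν.withDensity fun x => ENNReal.ofReal (Real.exp (g x)))
    (hg_int : Integrable g μ) :
    klDiv μ ν = ENNReal.ofReal (∫ x, g x ∂μ) := by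
  have hac : μ ≪ ν := by
    rw [hμ]
    exact withDensity_absolutelyContinuous _ _
  have hllr : llr μ ν =ᵐ[μ] g := by
    refine hac.ae_le ?_
    have hrn : μ.rnDeriv ν =ᵐ[ν] fun x => ENNReal.ofReal (Real.exp (g x)) := by
      rw [hμ]
      exact Measure.rnDeriv_withDensity _ (by fun_prop)
    filter_upwards [hrn] with x hx
    rw [llr, hx, ENNReal.toReal_ofReal (Real.exp_pos _).le, Real.log_exp]
  rw [klDiv_of_ac_of_integrable hac ((integrable_congr hllr).mpr hg_int), integral_congr_ae hllr]
  simp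

/-- A unit-variance Gaussian on the line has an exponential density with respect to the standard
one. -/
theorem gaussianReal_one_eq_withDensity (m : ℝ) :
    gaussianReal m 1 = (gaussianReal 0 1).withDensity
      fun x => ENNReal.ofReal (Real.exp (m * x - m ^ 2 / 2)) := by
  rw [gaussianReal_of_var_ne_zero _ one_ne_zero, gaussianReal_of_var_ne_zero _ one_ne_zero,
    ← withDensity_mul _ (measurable_gaussianPDF _ _) (by fun_prop)]
  congr 1
  ext x
  rw [Pi.mul_apply, gaussianPDF, gaussianPDF, ← ENNReal.ofReal_mul (gaussianPDFReal_nonneg _ _ _)]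
  congr 1
  rw [gaussianPDFReal, gaussianPDFReal, mul_assoc (_⁻¹), ← Real.exp_add]
  congr 2
  simp only [NNReal.coe_one]
  ring

/-- The density of a product of measures with densities on a finite product of probability
spaces. -/
theorem pi_withDensity {ι : Type*} [Fintype ι] {α : ι → Type*} [∀ i, MeasurableSpace (α i)]
    (μ : ∀ i, Measure (α i)) [∀ i, IsProbabilityMeasure (μ i)] {f : ∀ i, α i → ℝ≥0∞}
    (hf : ∀ i, Measurable (f i)) [∀ i, SigmaFinite ((μ i).withDensity (f i))] :
    Measure.pi (fun i => (μ i).withDensity (f i)) =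
      (Measure.pi μ).withDensity fun x => ∏ i, f i (x i) := by
  refine (Measure.pi_eq fun s hs => ?_)
  -- On a box the integrand, indicator included, is a product of functions of single coordinates,
  -- which are independent.
  have hind : (Set.univ.pi s).indicator (fun x : ∀ i, α i => ∏ i, f i (x i)) =
      fun x => ∏ i, (s i).indicator (f i) (x i) := by
    ext x
    by_cases hx : x ∈ Set.univ.pi s
    · rw [Set.indicator_of_mem hx]
      refine Finset.prod_congr rfl fun i _ => ?_
      rw [Set.indicator_of_mem (hx i (Set.mem_univ i))]
    · rw [Set.indicator_of_notMem hx]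
      simp only [Set.mem_pi, Set.mem_univ, true_implies, not_forall] at hx
      obtain ⟨i, hi⟩ := hx
      exact (Finset.prod_eq_zero (Finset.mem_univ i) (Set.indicator_of_notMem hi _)).symm
  rw [withDensity_apply _ (MeasurableSet.univ_pi hs),
    ← lintegral_indicator (MeasurableSet.univ_pi hs), hind]
  have hmeas : ∀ i, Measurable ((s i).indicator (f i)) := fun i => (hf i).indicator (hs i)
  have hindep : iIndepFun (fun i (x : ∀ i, α i) => (s i).indicator (f i) (x i)) (Measure.pi μ) :=
    iIndepFun_pi fun i => (hmeas i).aemeasurable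
  rw [lintegral_prod_eq_prod_lintegral_of_indepFun Finset.univ _ hindep
    fun i => (hmeas i).comp (measurable_pi_apply i)]
  refine Finset.prod_congr rfl fun i _ => ?_
  rw [withDensity_apply _ (hs i), ← lintegral_indicator (hs i)]
  exact ((measurePreserving_eval μ i).lintegral_comp (hmeas i))

/-- The divergence between a product of unit-variance Gaussians and the product of standard ones. -/
theorem klDiv_pi_gaussianReal {ι : Type*} [Fintype ι] (m : ι → ℝ) :
    klDiv (Measure.pi fun i => gaussianReal (m i) 1) (Measure.pi fun _ : ι => gaussianReal 0 1) =
      ENNReal.ofReal ((∑ i, m i ^ 2) / 2) := by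
  have hd : (Measure.pi fun i => gaussianReal (m i) 1) =
      (Measure.pi fun _ : ι => gaussianReal 0 1).withDensity
        fun x => ENNReal.ofReal (Real.exp (∑ i, (m i * x i - m i ^ 2 / 2))) := by
    have : ∀ i, SigmaFinite ((gaussianReal 0 1).withDensity
        fun x => ENNReal.ofReal (Real.exp (m i * x - m i ^ 2 / 2))) := fun i => by
      rw [← gaussianReal_one_eq_withDensity]
      infer_instance
    simp_rw [gaussianReal_one_eq_withDensity (m _)]
    rw [pi_withDensity _ fun i => by fun_prop]
    congr 1
    ext x
    rw [Real.exp_sum, ENNReal.ofReal_prod_of_nonneg fun i _ => (Real.exp_pos _).le]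
  have hx : ∀ i, Integrable (fun x : ι → ℝ => x i) (Measure.pi fun i => gaussianReal (m i) 1) :=
    fun i => integrable_eval (μ := fun i => gaussianReal (m i) 1) IsGaussian.integrable_id
  have hterm : ∀ i, Integrable (fun x : ι → ℝ => m i * x i - m i ^ 2 / 2)
      (Measure.pi fun i => gaussianReal (m i) 1) :=
    fun i => ((hx i).const_mul _).sub (integrable_const _)
  rw [klDiv_eq_ofReal_integral_of_withDensity_exp (by fun_prop) hd
    (integrable_finsetSum _ fun i _ => hterm i), integral_finsetSum _ fun i _ => hterm i]
  congr 1
  rw [Finset.sum_div]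
  refine Finset.sum_congr rfl fun i _ => ?_
  -- Coordinate `i` has mean `m i` under the shifted law, leaving `m i ^ 2 - m i ^ 2 / 2`.
  rw [integral_sub ((hx i).const_mul _) (integrable_const _), integral_const_mul,
    integral_eval (μ := fun i => gaussianReal (m i) 1), integral_id_gaussianReal]
  simp
  ring

/-- The divergence of a translated standard Gaussian from the standard Gaussian. -/
theorem klDiv_map_const_add_stdGaussian_le {d : ℕ} (v : EuclideanSpace ℝ (Fin d)) :
    klDiv ((stdGaussian (EuclideanSpace ℝ (Fin d))).map (v + ·))
      (stdGaussian (EuclideanSpace ℝ (Fin d))) ≤ ENNReal.ofReal (‖v‖ ^ 2 / 2) := by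
  have hshift : (Measure.pi fun i => gaussianReal (v i) 1).map (WithLp.toLp 2) =
      (stdGaussian (EuclideanSpace ℝ (Fin d))).map (v + ·) := by
    have h1 : (Measure.pi fun i => gaussianReal (v i) 1) =
        (Measure.pi fun _ : Fin d => gaussianReal 0 1).map (fun x i => v i + x i) := by
      rw [Measure.pi_map_pi fun i => by fun_prop]
      simp [gaussianReal_map_const_add]
    rw [h1, ← map_pi_eq_stdGaussian, Measure.map_map (by fun_prop) (by fun_prop),
      Measure.map_map (by fun_prop) (by fun_prop)]
    rfl
  rw [← hshift]
  conv_lhs => rw [← map_pi_eq_stdGaussian]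
  refine (klDiv_map_le _ _ (by fun_prop)).trans ?_
  rw [klDiv_pi_gaussianReal, EuclideanSpace.real_norm_sq_eq]

/-- The divergence between two Gaussians with the same isotropic covariance. -/
theorem klDiv_map_add_smul_stdGaussian_le {d : ℕ} (m₁ m₂ : EuclideanSpace ℝ (Fin d)) {s : ℝ}
    (hs : 0 < s) :
    klDiv ((stdGaussian (EuclideanSpace ℝ (Fin d))).map fun z => m₁ + s • z)
        ((stdGaussian (EuclideanSpace ℝ (Fin d))).map fun z => m₂ + s • z) ≤
      ENNReal.ofReal (‖m₁ - m₂‖ ^ 2 / (2 * s ^ 2)) := by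
  -- Both laws are images under `z ↦ m₂ + s • z`, so data processing reduces to a shifted standard
  -- Gaussian.
  have h1 : ((stdGaussian (EuclideanSpace ℝ (Fin d))).map fun z => m₁ + s • z) =
      ((stdGaussian (EuclideanSpace ℝ (Fin d))).map (s⁻¹ • (m₁ - m₂) + ·)).map
        fun z => m₂ + s • z := by
    rw [Measure.map_map (by fun_prop) (by fun_prop)]
    congr 1
    ext1 z
    simp only [Function.comp_apply, smul_add, smul_smul, mul_inv_cancel₀ hs.ne', one_smul]
    abel
  rw [h1]
  refine (klDiv_map_le _ _ (by fun_prop)).trans ((klDiv_map_const_add_stdGaussian_le _).trans ?_)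
  refine le_of_eq (congrArg _ ?_)
  rw [norm_smul, norm_inv, Real.norm_of_nonneg hs.le]
  field_simp

/-! ### The Euler chain and its translations. -/

theorem eulerKernel_apply {d : ℕ} (b : EuclideanSpace ℝ (Fin d) → EuclideanSpace ℝ (Fin d))
    (hb : Measurable b) (δ T : ℝ) (x : EuclideanSpace ℝ (Fin d)) :
    eulerKernel b hb δ T x = (stdGaussian (EuclideanSpace ℝ (Fin d))).map
      fun z => x + δ • b x + √(2 * T * δ) • z :=
  rfl

instance isMarkovKernel_eulerKernel {d : ℕ}
    (b : EuclideanSpace ℝ (Fin d) → EuclideanSpace ℝ (Fin d)) (hb : Measurable b) (δ T : ℝ) :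
    IsMarkovKernel (eulerKernel b hb δ T) where
  isProbabilityMeasure x := by
    rw [eulerKernel_apply]
    exact Measure.isProbabilityMeasure_map (by fun_prop)

theorem lawAfter_zero {α : Type*} [MeasurableSpace α] (μ : Measure α) (Q : Kernel α α) :
    lawAfter μ Q 0 = μ := by
  rw [lawAfter, pow_zero]
  exact Measure.id_comp

theorem lawAfter_succ {α : Type*} [MeasurableSpace α] (μ : Measure α) (Q : Kernel α α) (n : ℕ) :
    lawAfter μ Q (n + 1) = (lawAfter μ Q n).bind Q := by
  rw [lawAfter, lawAfter, pow_succ', Measure.comp_assoc]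
  rfl

instance isProbabilityMeasure_lawAfter {α : Type*} [MeasurableSpace α] (μ : Measure α)
    [IsProbabilityMeasure μ] (Q : Kernel α α) [IsMarkovKernel Q] (n : ℕ) :
    IsProbabilityMeasure (lawAfter μ Q n) := by
  induction n with
  | zero => rwa [lawAfter_zero]
  | succ n ih =>
    rw [lawAfter_succ]
    infer_instance

/-- One step of the Euler chain, where the law on the left is translated by `a` before the step and
by `a'` after it. -/
theorem klDiv_map_add_bind_eulerKernel_le {d : ℕ}
    {b : EuclideanSpace ℝ (Fin d) → EuclideanSpace ℝ (Fin d)} {L : ℝ≥0} (hb : LipschitzWith L b)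
    {δ T : ℝ} (hδ : 0 < δ) (hT : 0 < T) (μ ν : Measure (EuclideanSpace ℝ (Fin d)))
    [IsProbabilityMeasure μ] [IsProbabilityMeasure ν] (a a' : EuclideanSpace ℝ (Fin d)) :
    klDiv ((μ.bind (eulerKernel b hb.continuous.measurable δ T)).map (· + a'))
        (ν.bind (eulerKernel b hb.continuous.measurable δ T)) ≤
      klDiv (μ.map (· + a)) ν
        + ENNReal.ofReal ((δ * L * ‖a‖ + ‖a' - a‖) ^ 2 / (4 * T * δ)) := by
  set Q := eulerKernel b hb.continuous.measurable δ T with hQ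
  have hsub : Measurable fun z : EuclideanSpace ℝ (Fin d) => z - a := by fun_prop
  have hadd : ∀ u : EuclideanSpace ℝ (Fin d), Measurable (· + u) := fun u => by fun_prop
  have := Kernel.IsMarkovKernel.map Q (hadd a')
  -- The translated chain is itself Markov: undo the shift `a`, make a step, then shift by `a'`.
  have hlaw : (μ.bind Q).map (· + a') = (μ.map (· + a)).bind ((Q.map (· + a')).comap _ hsub) := by
    ext s hs
    rw [Measure.map_comp _ _ (hadd a'), Measure.bind_apply hs (Kernel.aemeasurable _),
      Measure.bind_apply hs (Kernel.aemeasurable _),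
      lintegral_map (Kernel.measurable_coe _ hs) (hadd a)]
    simp [Kernel.comap_apply]
  have := Measure.isProbabilityMeasure_map (μ := μ) (hadd a).aemeasurable
  rw [hlaw]
  refine klDiv_bind_le_add _ _ _ _ ENNReal.ofReal_ne_top fun z => ?_
  have hpos : 0 < 2 * T * δ := by positivity
  have hz : (Q.map (· + a')).comap _ hsub z = (stdGaussian (EuclideanSpace ℝ (Fin d))).map
      fun w => (z - a + δ • b (z - a) + a') + √(2 * T * δ) • w := by
    rw [Kernel.comap_apply, Kernel.map_apply _ (hadd a'), hQ, eulerKernel_apply,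
      Measure.map_map (hadd a') (by fun_prop)]
    congr 1
    ext1 w
    simp only [Function.comp_apply]
    abel
  rw [hz, hQ, eulerKernel_apply]
  refine (klDiv_map_add_smul_stdGaussian_le _ _ (Real.sqrt_pos.mpr hpos)).trans
    (ENNReal.ofReal_le_ofReal ?_)
  rw [Real.sq_sqrt hpos.le, show 2 * (2 * T * δ) = 4 * T * δ by ring]
  gcongr
  calc ‖z - a + δ • b (z - a) + a' - (z + δ • b z)‖
      = ‖δ • (b (z - a) - b z) + (a' - a)‖ := by
        rw [smul_sub]
        congr 1
        abel
    _ ≤ ‖δ • (b (z - a) - b z)‖ + ‖a' - a‖ := norm_add_le _ _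
    _ ≤ δ * L * ‖a‖ + ‖a' - a‖ := by
        have h := hb.norm_sub_le (z - a) z
        rw [sub_sub_cancel_left, norm_neg] at h
        rw [norm_smul, Real.norm_of_nonneg hδ.le, mul_assoc]
        gcongr

/-- After `n` steps, the divergence between the laws of two Euler chains started at `y` and `x` is
bounded in terms of the Lipschitz constant of the drift alone: translating the chain started at `y`
by `(1 - k / n) • (x - y)` at time `k` gives a chain started at `x` with the same final law. -/
theorem klDiv_lawAfter_eulerKernel_le {d : ℕ}
    {b : EuclideanSpace ℝ (Fin d) → EuclideanSpace ℝ (Fin d)} {L : ℝ≥0} (hb : LipschitzWith L b)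
    {δ T : ℝ} (hδ : 0 < δ) (hT : 0 < T) {n : ℕ} (hn : 0 < n) (x y : EuclideanSpace ℝ (Fin d)) :
    klDiv (lawAfter (Measure.dirac y) (eulerKernel b hb.continuous.measurable δ T) n)
        (lawAfter (Measure.dirac x) (eulerKernel b hb.continuous.measurable δ T) n) ≤
      ENNReal.ofReal (n * ((δ * L * ‖x - y‖ + ‖x - y‖ / n) ^ 2 / (4 * T * δ))) := by
  set Q := eulerKernel b hb.continuous.measurable δ T with hQ
  have hn' : (0 : ℝ) < n := by exact_mod_cast hn
  have key : ∀ k ≤ n, klDiv ((lawAfter (Measure.dirac y) Q k).map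
      (· + (1 - (k : ℝ) / n) • (x - y))) (lawAfter (Measure.dirac x) Q k) ≤
      ENNReal.ofReal (k * ((δ * L * ‖x - y‖ + ‖x - y‖ / n) ^ 2 / (4 * T * δ))) := by
    intro k
    induction k with
    | zero =>
      intro _
      rw [lawAfter_zero, lawAfter_zero,
        Measure.map_dirac' (measurable_add_const ((1 - ((0 : ℕ) : ℝ) / n) • (x - y)))]
      simp [klDiv_self]
    | succ k ih =>
      intro hk
      have hkn : (k : ℝ) / n ≤ 1 := by
        rw [div_le_one hn']
        exact_mod_cast (Nat.le_succ k).trans hk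
      have hk0 : (0 : ℝ) ≤ (k : ℝ) / n := by positivity
      have h1 : ‖(1 - (k : ℝ) / n) • (x - y)‖ ≤ ‖x - y‖ := by
        rw [norm_smul, Real.norm_of_nonneg (by linarith)]
        exact mul_le_of_le_one_left (norm_nonneg _) (by linarith)
      have h2 : ‖(1 - ((k + 1 : ℕ) : ℝ) / n) • (x - y) - (1 - (k : ℝ) / n) • (x - y)‖ =
          ‖x - y‖ / n := by
        rw [← sub_smul, show 1 - ((k + 1 : ℕ) : ℝ) / n - (1 - (k : ℝ) / n) = -(1 / n) by
          push_cast; ring, norm_smul, norm_neg, Real.norm_of_nonneg (by positivity)]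
        ring
      rw [lawAfter_succ, lawAfter_succ]
      refine (klDiv_map_add_bind_eulerKernel_le hb hδ hT _ _
        ((1 - (k : ℝ) / n) • (x - y)) _).trans ?_
      rw [h2]
      refine (add_le_add (ih ((Nat.le_succ k).trans hk)) (ENNReal.ofReal_le_ofReal
        (q := (δ * L * ‖x - y‖ + ‖x - y‖ / n) ^ 2 / (4 * T * δ)) (by gcongr))).trans ?_
      rw [← ENNReal.ofReal_add (by positivity) (by positivity)]
      refine le_of_eq (congrArg _ ?_)
      push_cast
      ring
  have h := key n le_rfl
  simpa [div_self hn'.ne'] using h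

theorem mainTheorem7 {d : ℕ} (b : EuclideanSpace ℝ (Fin d) → EuclideanSpace ℝ (Fin d))
    (L C : ℝ≥0) (hL : 0 < L) (hC : 0 < C)
    (hb : LipschitzWith L b)
    (hb_diff : Differentiable ℝ b) (hb_jac : LipschitzWith C (fderiv ℝ b))
    (T c δ : ℝ) (hT : 0 < T) (hc : 0 < c)
    (hδ : 0 < δ) (hδ_le : δ ≤ 1 / (16 * c * (L : ℝ) ^ 2 * Real.exp (2 * c * L)))
    (n : ℕ) (hn : 2 ≤ n) (hnδ : δ * n < c) (x y : EuclideanSpace ℝ (Fin d)) :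
    klDiv (lawAfter (Measure.dirac y) (eulerKernel b hb.continuous.measurable δ T) n)
        (lawAfter (Measure.dirac x) (eulerKernel b hb.continuous.measurable δ T) n) ≤
      ENNReal.ofReal
        ((1 / (2 * T) * (c * (L : ℝ) ^ 2 + 1 / (n * δ))
          + 1 / 2 * c ^ 2 * (C : ℝ) ^ 2 * d * Real.exp (2 * c * L)) * ‖x - y‖ ^ 2) := by
  have hn0 : 0 < n := by omega
  have hn' : (0 : ℝ) < n := by exact_mod_cast hn0
  refine (klDiv_lawAfter_eulerKernel_le hb hδ hT hn0 x y).trans (ENNReal.ofReal_le_ofReal ?_)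
  set r := ‖x - y‖
  calc n * ((δ * L * r + r / n) ^ 2 / (4 * T * δ))
      -- Squaring separates the drift cost, which grows with `n * δ`, from the shift cost, of order
      -- `1 / (n * δ)`.
      ≤ n * (2 * ((δ * L * r) ^ 2 + (r / n) ^ 2) / (4 * T * δ)) := by
        gcongr
        exact add_sq_le
    _ = 1 / (2 * T) * (δ * n * (L : ℝ) ^ 2 + 1 / (n * δ)) * r ^ 2 := by
        field_simp
        ring
    _ ≤ 1 / (2 * T) * (c * (L : ℝ) ^ 2 + 1 / (n * δ)) * r ^ 2 := by gcongr
    _ ≤ _ := by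
        gcongr
        exact le_add_of_nonneg_right (by positivity)
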